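/- For real $p$ with $0<p<1$ and real $z\neq0$ let $\theta(z;p)=\prod_{j=0}^{\infty}(1-zp^{j})(1-p^{j+1}/z)$ be the modified Jacobi theta function, and write $\theta(z_1,\dots,z_m;p)=\theta(z_1;p)\cdots\theta(z_m;p)$. For real $x$ the elliptic number with real parameters $a,b,q,p$ (where $a,b\neq 0$, $q>0$) is $$[x]_{a,b;q,p}=\frac{\theta(q^x,aq^x,bq,aq/b;p)}{\theta(q,aq,bq^x,aq^x/b;p)},$$ where a quotient with zero denominator is read as $0$. Theorem. The elliptic numbers are continuously strongly log-concave in the following sense. For all real numbers $q,p,x,y,r,a,b$ satisfying $0<q<1$, $0<p<q^{2r}$, $x\ge y\ge r\ge 0$ and $pq^{-x-r}<a<b<1$, we have $$[x]_{a,b;q,p}\,[y]_{a,b;q,p}\;\ge\;[x+r]_{a,b;q,p}\,[y-r]_{a,b;q,p}.$$ -/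

import Mathlib

noncomputable section

/-- The infinite `p`-shifted factorial `(x; p)_∞ = ∏_{j ≥ 0} (1 - x p ^ j)`, for `|p| < 1`. -/
def infShiftedFactorial (x p : ℝ) : ℝ :=
  ∏' j : ℕ, (1 - x * p ^ j)

/-- The product defining `(x; p)_∞` converges for `|p| < 1`. -/
theorem multipliable_infShiftedFactorial (x p : ℝ) (hp : |p| < 1) :
    Multipliable fun j : ℕ => 1 - x * p ^ j := by
  have h : Summable fun j : ℕ => ‖-(x * p ^ j)‖ := by
    have h1 : Summable fun j : ℕ => |x| * |p| ^ j :=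
      (summable_geometric_of_lt_one (abs_nonneg p) hp).mul_left _
    simpa [abs_mul, abs_pow] using h1
  simpa [sub_eq_add_neg] using multipliable_one_add_of_summable h

/-- The modified Jacobi theta function `θ(x; p) = (x; p)_∞ (p / x; p)_∞` of argument `x ≠ 0` and
nome `p`, `|p| < 1`. -/
def modifiedTheta (x p : ℝ) : ℝ :=
  infShiftedFactorial x p * infShiftedFactorial (p / x) p

/-- The elliptic number `[x]_{a,b;q,p}`, for real parameters. -/
def ellipticNumber (a b q p x : ℝ) : ℝ :=
  (modifiedTheta (q ^ x) p * modifiedTheta (a * q ^ x) p *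
      modifiedTheta (b * q) p * modifiedTheta (a * q / b) p) /
    (modifiedTheta q p * modifiedTheta (a * q) p *
      modifiedTheta (b * q ^ x) p * modifiedTheta (a * q ^ x / b) p)

end

/-!
The elliptic number is, up to a constant factor, the value at `u = q ^ x` of
`θ(u) θ(c d u) / (θ(c u) θ(d u))` with `c = b` and `d = a / b`. The claim therefore compares the
points `X R ≤ X ≤ Y ≤ Y / R`, where `X = q ^ x`, `Y = q ^ y`, `R = q ^ r`; the two outer points
have the same product as the two inner ones.

After clearing denominators, the inequality holds for every factor of the infinite products
separately. Put `F(w) = (1 - w) (1 - c d w) / ((1 - c w) (1 - d w))`. For points with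
`w₁ w₄ = w₂ w₃ = m`, the value `F(w₂) F(w₃)` is a quotient `N(s) / (N(s) + δ(s))`, where
`s = w₂ + w₃`, the function `N` is nonnegative and decreasing, and `δ` is affine, nonnegative and
increasing; so it decreases when `s` grows to `w₁ + w₄`. This is `inner_mul_outer_ge`. The factors
`1 - z p ^ j` are the case `w = u p ^ j`, and the factors `1 - p ^ (j + 1) / z` are the case
`w = p ^ (j + 1) / u` with `c`, `d` replaced by their inverses. Multiplying over `j` and passing
to the limit gives the inequality for theta functions (`theta_inner_mul_outer_ge`). The conditions
on the parameters place every `x`-dependent argument of a theta function strictly between `p` and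
`1`, or at `1` in the numerator, so that the denominators depending on `x` are positive.
-/

/-! ### The inequality for a single factor -/

/-- The cleared-denominator form of `F(w₂) F(w₃) ≥ F(w₁) F(w₄)`, where
`F(w) = (1 - w) (1 - c d w) / ((1 - c w) (1 - d w))`, for inner points `w₂`, `w₃` and outer points
`w₁`, `w₄` with the same product. -/
theorem inner_mul_outer_ge {c d w₁ w₂ w₃ w₄ : ℝ} (hc : 0 < c) (hd : 0 < d)
    (hcd : 0 ≤ (1 - c) * (1 - d)) (hw₂ : 0 < w₂) (hw₃ : 0 < w₃)
    (hm : w₁ * w₄ = w₂ * w₃) (h₂ : w₂ ≤ w₄) (h₃ : w₃ ≤ w₄)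
    (h : w₄ ≤ 1) (hcw : c * w₄ ≤ 1) (hdw : d * w₄ ≤ 1) (hcdw : c * d * w₄ ≤ 1) :
    0 ≤ (1 - w₁) * (1 - c * d * w₁) * (1 - w₄) * (1 - c * d * w₄) *
        ((1 - c * w₂) * (1 - d * w₂) * (1 - c * w₃) * (1 - d * w₃)) ∧
    (1 - w₁) * (1 - c * d * w₁) * (1 - w₄) * (1 - c * d * w₄) *
        ((1 - c * w₂) * (1 - d * w₂) * (1 - c * w₃) * (1 - d * w₃)) ≤
      (1 - w₂) * (1 - c * d * w₂) * (1 - w₃) * (1 - c * d * w₃) *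
        ((1 - c * w₁) * (1 - d * w₁) * (1 - c * w₄) * (1 - d * w₄)) := by
  have hw₄ : 0 < w₄ := hw₂.trans_le h₂
  have h₁ : w₁ ≤ w₄ := by
    by_contra! hlt
    nlinarith [mul_le_mul h₂ h₃ hw₃.le hw₄.le, mul_lt_mul_of_pos_right hlt hw₄]
  -- A factor `1 - e w` is nonnegative at every point once it is so at `w₄`.
  have key : ∀ {e : ℝ}, 0 < e → e * w₄ ≤ 1 → ∀ {w : ℝ}, w ≤ w₄ → 0 ≤ 1 - e * w := by
    intro e he hew w hw
    nlinarith [mul_le_mul_of_nonneg_left hw he.le]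
  have hcd' : 0 < c * d := mul_pos hc hd
  have k1 : ∀ {w : ℝ}, w ≤ w₄ → 0 ≤ 1 - w := fun hw => by linarith
  set m := w₂ * w₃ with hmdef
  have hs : w₂ + w₃ ≤ w₁ + w₄ := by
    have : 0 ≤ w₄ * (w₁ + w₄ - (w₂ + w₃)) := by
      nlinarith [mul_nonneg (sub_nonneg.2 h₂) (sub_nonneg.2 h₃)]
    nlinarith [nonneg_of_mul_nonneg_right this hw₄]
  set s := w₂ + w₃ with hsdef
  set S := w₁ + w₄ with hSdef
  have pair₂₃ (e : ℝ) : (1 - e * w₂) * (1 - e * w₃) = 1 - e * s + e ^ 2 * m := by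
    rw [hsdef, hmdef]; ring
  have pair₁₄ (e : ℝ) : (1 - e * w₁) * (1 - e * w₄) = 1 - e * S + e ^ 2 * m := by
    rw [hSdef, ← hm]; ring
  have hN₁ : 0 ≤ 1 - S + m := by
    have := pair₁₄ 1
    have := mul_nonneg (k1 h₁) (k1 le_rfl)
    linarith
  have hN₂ : 0 ≤ 1 - c * d * S + (c * d) ^ 2 * m := by
    rw [← pair₁₄]; exact mul_nonneg (key hcd' hcdw h₁) (key hcd' hcdw le_rfl)
  have hδ : 0 ≤ (1 + c * d * m) * s - m * ((1 + c) * (1 + d)) := by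
    have e : (1 + c * d * m) * s - m * ((1 + c) * (1 + d)) =
        w₂ * ((1 - w₃) * (1 - c * d * w₃)) + w₃ * ((1 - c * w₂) * (1 - d * w₂)) := by
      rw [hsdef, hmdef]; ring
    rw [e]
    exact add_nonneg
      (mul_nonneg hw₂.le (mul_nonneg (k1 h₃) (key hcd' hcdw h₃)))
      (mul_nonneg hw₃.le (mul_nonneg (key hc hcw h₂) (key hd hdw h₂)))
  have hδle : (1 + c * d * m) * s - m * ((1 + c) * (1 + d)) ≤
      (1 + c * d * m) * S - m * ((1 + c) * (1 + d)) := by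
    have : 0 ≤ 1 + c * d * m := by positivity
    linarith [mul_le_mul_of_nonneg_left hs this]
  have hNle : (1 - S + m) * (1 - c * d * S + (c * d) ^ 2 * m) ≤
      (1 - s + m) * (1 - c * d * s + (c * d) ^ 2 * m) := by
    have := mul_le_mul_of_nonneg_left hs hcd'.le
    exact mul_le_mul (by linarith) (by linarith) hN₂ (by linarith)
  -- `(1 - c s + c² m) (1 - d s + d² m) = N(s) + δ(s)`, so the terms `N(s) N(S)` cancel.
  have main := mul_le_mul_of_nonneg_left
    (mul_le_mul hNle hδle hδ ((mul_nonneg hN₁ hN₂).trans hNle)) hcd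
  have eL : (1 - w₁) * (1 - c * d * w₁) * (1 - w₄) * (1 - c * d * w₄) *
      ((1 - c * w₂) * (1 - d * w₂) * (1 - c * w₃) * (1 - d * w₃)) =
      (1 - S + m) * (1 - c * d * S + (c * d) ^ 2 * m) *
        ((1 - c * s + c ^ 2 * m) * (1 - d * s + d ^ 2 * m)) := by
    rw [← pair₁₄, ← pair₂₃, ← pair₂₃]
    linear_combination -((1 - c * d * w₁) * (1 - c * d * w₄) *
      ((1 - c * w₂) * (1 - d * w₂) * (1 - c * w₃) * (1 - d * w₃))) * (hmdef - hm)
  have eR : (1 - w₂) * (1 - c * d * w₂) * (1 - w₃) * (1 - c * d * w₃) *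
      ((1 - c * w₁) * (1 - d * w₁) * (1 - c * w₄) * (1 - d * w₄)) =
      (1 - s + m) * (1 - c * d * s + (c * d) ^ 2 * m) *
        ((1 - c * S + c ^ 2 * m) * (1 - d * S + d ^ 2 * m)) := by
    rw [← pair₂₃, ← pair₁₄, ← pair₁₄, hsdef, hmdef]
    ring
  refine ⟨?_, ?_⟩
  · have := k1 h₁
    have := k1 le_rfl
    have := key hcd' hcdw h₁
    have := key hcd' hcdw le_rfl
    have := key hc hcw h₂
    have := key hc hcw h₃
    have := key hd hdw h₂
    have := key hd hdw h₃
    positivity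
  · rw [eL, eR]
    linear_combination main

/-! ### Theta functions as limits of finite products -/

theorem infShiftedFactorial_pos {x p : ℝ} (hp₀ : 0 < p) (hp₁ : p < 1) (hx : x < 1) :
    0 < infShiftedFactorial x p := by
  have hp : |p| < 1 := by rwa [abs_of_pos hp₀]
  have hpos (j : ℕ) : 0 < 1 - x * p ^ j := by
    have h1 : p ^ j ≤ 1 := pow_le_one₀ hp₀.le hp₁.le
    have h0 : 0 < p ^ j := pow_pos hp₀ j
    nlinarith [mul_lt_mul_of_pos_right hx h0]
  have hs : Summable fun j : ℕ => Real.log (1 + -(x * p ^ j)) :=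
    Real.summable_log_one_add_of_summable
      (((summable_geometric_of_lt_one hp₀.le hp₁).mul_left x).neg)
  unfold infShiftedFactorial
  rw [← Real.rexp_tsum_eq_tprod hpos (by simpa [sub_eq_add_neg] using hs)]
  exact Real.exp_pos _

theorem modifiedTheta_pos {x p : ℝ} (hp₀ : 0 < p) (hpx : p < x) (hx : x < 1) :
    0 < modifiedTheta x p :=
  mul_pos (infShiftedFactorial_pos hp₀ (hpx.trans hx) hx)
    (infShiftedFactorial_pos hp₀ (hpx.trans hx) ((div_lt_one (hp₀.trans hpx)).2 hpx))

theorem tendsto_prod_modifiedTheta (x : ℝ) {p : ℝ} (hp₀ : 0 < p) (hp₁ : p < 1) :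
    Filter.Tendsto
      (fun n => ∏ j ∈ Finset.range n, (1 - x * p ^ j) * (1 - p / x * p ^ j))
      Filter.atTop (nhds (modifiedTheta x p)) := by
  have hp : |p| < 1 := by rwa [abs_of_pos hp₀]
  simp only [Finset.prod_mul_distrib]
  exact (multipliable_infShiftedFactorial x p hp).hasProd.tendsto_prod_nat.mul
    (multipliable_infShiftedFactorial (p / x) p hp).hasProd.tendsto_prod_nat

/-! ### The inequality for theta functions -/

/-- The cleared-denominator form of the inequality of the theorem, for the points
`X R ≤ X ≤ Y ≤ Y / R`. -/
theorem theta_inner_mul_outer_ge {p c d X Y R : ℝ} (hp₀ : 0 < p) (hp₁ : p < 1)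
    (hc : 0 < c) (hc₁ : c ≤ 1) (hd : 0 < d) (hd₁ : d ≤ 1) (hX : 0 < X) (hXY : X ≤ Y)
    (hYR : Y ≤ R) (hR₁ : R ≤ 1) (hp : p ≤ c * d * (X * R)) :
    modifiedTheta (X * R) p * modifiedTheta (c * d * (X * R)) p *
          modifiedTheta (Y / R) p * modifiedTheta (c * d * (Y / R)) p *
        (modifiedTheta (c * X) p * modifiedTheta (d * X) p *
          modifiedTheta (c * Y) p * modifiedTheta (d * Y) p) ≤
      modifiedTheta X p * modifiedTheta (c * d * X) p *
          modifiedTheta Y p * modifiedTheta (c * d * Y) p *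
        (modifiedTheta (c * (X * R)) p * modifiedTheta (d * (X * R)) p *
          modifiedTheta (c * (Y / R)) p * modifiedTheta (d * (Y / R)) p) := by
  have hY : 0 < Y := hX.trans_le hXY
  have hR : 0 < R := hY.trans_le hYR
  have hXR : 0 < X * R := mul_pos hX hR
  have hYR₁ : Y / R ≤ 1 := (div_le_one hR).2 hYR
  have hYYR : Y ≤ Y / R := (le_div_iff₀ hR).2 (mul_le_of_le_one_right hY.le hR₁)
  have hXRX : X * R ≤ X := mul_le_of_le_one_right hX.le hR₁
  have hcd₁ : c * d ≤ 1 := mul_le_one₀ hc₁ hd.le hd₁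
  have T (x : ℝ) := tendsto_prod_modifiedTheta x hp₀ hp₁
  refine le_of_tendsto_of_tendsto'
    ((((T _).mul (T _)).mul (T _) |>.mul (T _)).mul ((((T _).mul (T _)).mul (T _)).mul (T _)))
    ((((T _).mul (T _)).mul (T _) |>.mul (T _)).mul ((((T _).mul (T _)).mul (T _)).mul (T _)))
    fun n => ?_
  simp only [← Finset.prod_mul_distrib]
  have fac (j : ℕ) := inner_mul_outer_ge (c := c) (d := d) (w₁ := X * R * p ^ j)
    (w₂ := X * p ^ j) (w₃ := Y * p ^ j) (w₄ := Y / R * p ^ j) hc hd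
    (mul_nonneg (sub_nonneg.2 hc₁) (sub_nonneg.2 hd₁)) (by positivity) (by positivity)
    (by field_simp) (by gcongr; exact hXY.trans hYYR) (by gcongr)
  have fac' (j : ℕ) := inner_mul_outer_ge (c := c⁻¹) (d := d⁻¹) (w₁ := p / (Y / R) * p ^ j)
    (w₂ := p / Y * p ^ j) (w₃ := p / X * p ^ j) (w₄ := p / (X * R) * p ^ j)
    (by positivity) (by positivity)
    (mul_nonneg_of_nonpos_of_nonpos (sub_nonpos.2 (one_le_inv₀ hc |>.2 hc₁))
      (sub_nonpos.2 (one_le_inv₀ hd |>.2 hd₁)))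
    (by positivity) (by positivity) (by field_simp)
    (by gcongr; exact hXRX.trans hXY) (by gcongr)
  -- All upper bounds needed at the outermost points reduce to bounds at `j = 0`.
  have le_one {e t : ℝ} (j : ℕ) (ht : e * t ≤ 1) : e * (t * p ^ j) ≤ 1 := by
    have h1 : p ^ j ≤ 1 := pow_le_one₀ hp₀.le hp₁.le
    have h0 : 0 < p ^ j := pow_pos hp₀ j
    nlinarith [mul_le_mul_of_nonneg_right ht h0.le]
  have le_one' {e : ℝ} (he : 0 < e) (he₁ : e ≤ 1) : e * (Y / R) ≤ 1 :=
    mul_le_one₀ he₁ (by positivity) hYR₁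
  have inv_le_one' {e : ℝ} (he : 0 < e) (hcde : c * d ≤ e) : e⁻¹ * (p / (X * R)) ≤ 1 := by
    rw [inv_mul_le_iff₀ he, div_le_iff₀ hXR, mul_one]
    exact hp.trans (mul_le_mul_of_nonneg_right hcde hXR.le)
  have A (j : ℕ) := fac j (by simpa using le_one (e := 1) j (by simpa using hYR₁))
    (le_one j (le_one' hc hc₁)) (le_one j (le_one' hd hd₁))
    (le_one j (le_one' (mul_pos hc hd) hcd₁))
  have B (j : ℕ) := fac' j
    (by simpa using le_one (e := 1) j (by simpa using inv_le_one' one_pos hcd₁))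
    (le_one j (inv_le_one' hc (mul_le_of_le_one_right hc.le hd₁)))
    (le_one j (inv_le_one' hd (mul_le_of_le_one_left hd.le hc₁)))
    (by rw [← mul_inv]; exact le_one j (inv_le_one' (mul_pos hc hd) le_rfl))
  -- The factors `1 - p ^ (j + 1) / z` of `θ(e v)` are those of the point `p / v` with `e⁻¹`.
  have pair (e v : ℝ) (j : ℕ) : (1 - e * v * p ^ j) * (1 - p / (e * v) * p ^ j) =
      (1 - e * (v * p ^ j)) * (1 - e⁻¹ * (p / v * p ^ j)) := by
    rw [div_mul_eq_div_div_swap, div_eq_inv_mul (p / v) e, mul_assoc, mul_assoc]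
  simp only [pair (c * d), pair c, pair d, mul_inv]
  -- With `1 - w` hidden behind an opaque function, `ring` only has to permute the factors.
  obtain ⟨f, hf⟩ : ∃ f : ℝ → ℝ, ∀ w, 1 - w = f w := ⟨_, fun _ => rfl⟩
  simp only [hf] at A B ⊢
  refine Finset.prod_le_prod (fun j _ => ?_) (fun j _ => ?_)
  · refine (mul_nonneg (A j).1 (B j).1).trans_eq ?_
    ring
  · refine Eq.trans_le ?_ ((mul_le_mul (A j).2 (B j).2 (B j).1
      ((A j).1.trans (A j).2)).trans_eq ?_) <;> ring

/-! ### Strong log-concavity of the elliptic numbers -/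

theorem mainTheorem3 (q p x y r a b : ℝ)
    (hq0 : 0 < q) (hq1 : q < 1) (hp0 : 0 < p) (hp1 : p < q ^ (2 * r))
    (hxy : x ≥ y) (hyr : y ≥ r) (hr : r ≥ 0)
    (ha : p * q ^ (-x - r) < a) (hab : a < b) (hb : b < 1) :
    ellipticNumber a b q p x * ellipticNumber a b q p y ≥
      ellipticNumber a b q p (x + r) * ellipticNumber a b q p (y - r) := by
  have hp₁ : p < 1 := hp1.trans_le (Real.rpow_le_one hq0.le hq1.le (by linarith))
  have ha₀ : 0 < a := (mul_pos hp0 (Real.rpow_pos_of_pos hq0 _)).trans ha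
  have hb₀ : 0 < b := ha₀.trans hab
  have hX : 0 < q ^ x := Real.rpow_pos_of_pos hq0 x
  have hR : 0 < q ^ r := Real.rpow_pos_of_pos hq0 r
  have hR₁ : q ^ r ≤ 1 := Real.rpow_le_one hq0.le hq1.le hr
  have hXY : q ^ x ≤ q ^ y := Real.rpow_le_rpow_of_exponent_ge hq0 hq1.le hxy
  have hYR : q ^ y ≤ q ^ r := Real.rpow_le_rpow_of_exponent_ge hq0 hq1.le hyr
  have hp : p < a * (q ^ x * q ^ r) := by
    rw [show -x - r = -(x + r) by ring, Real.rpow_neg hq0.le, Real.rpow_add hq0,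
      ← div_eq_mul_inv, div_lt_iff₀ (mul_pos hX hR)] at ha
    exact ha
  unfold ellipticNumber
  rw [Real.rpow_add hq0, Real.rpow_sub hq0]
  generalize q ^ x = X at *
  generalize q ^ y = Y at *
  generalize q ^ r = R at *
  have hd₀ : 0 < a / b := div_pos ha₀ hb₀
  have hd₁ : a / b < 1 := (div_lt_one hb₀).2 hab
  have hbd : b * (a / b) = a := mul_div_cancel₀ a hb₀.ne'
  have main := theta_inner_mul_outer_ge hp0 hp₁ hb₀ hb.le hd₀ hd₁.le hX hXY hYR hR₁
    (by rw [hbd]; exact hp.le)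
  have hXR : 0 < X * R := mul_pos hX hR
  have hXRX : X * R ≤ X := mul_le_of_le_one_right hX.le hR₁
  have hYYR : Y ≤ Y / R := (le_div_iff₀ hR).2 (mul_le_of_le_one_right (hX.le.trans hXY) hR₁)
  have hYR₁ : Y / R ≤ 1 := (div_le_one hR).2 hYR
  -- Positivity of the denominators, for all points between `X R` and `Y / R`.
  have pos {e v : ℝ} (hae : a ≤ e) (he : e < 1) (hv : X * R ≤ v) (hv₁ : v ≤ Y / R) :
      0 < modifiedTheta (e * v) p := by
    have he₀ : 0 < e := ha₀.trans_le hae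
    refine modifiedTheta_pos hp0 (hp.trans_le (mul_le_mul hae hv hXR.le he₀.le)) ?_
    exact (mul_le_of_le_one_right he₀.le (hv₁.trans hYR₁)).trans_lt he
  have had : a ≤ a / b := by
    rw [le_div_iff₀ hb₀]; exact mul_le_of_le_one_right ha₀.le hb.le
  have hXRY : X * R ≤ Y := hXRX.trans hXY
  have hXRYR : X * R ≤ Y / R := hXRY.trans hYYR
  have p₁ := mul_pos (pos hab.le hb le_rfl hXRYR) (pos had hd₁ le_rfl hXRYR)
  have p₂ := mul_pos (pos hab.le hb hXRX (hXY.trans hYYR)) (pos had hd₁ hXRX (hXY.trans hYYR))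
  have p₃ := mul_pos (pos hab.le hb hXRY hYYR) (pos had hd₁ hXRY hYYR)
  have p₄ := mul_pos (pos hab.le hb hXRYR le_rfl) (pos had hd₁ hXRYR le_rfl)
  rw [hbd] at main
  -- The factor of `[x]` that does not depend on `x` enters only through its square. Neither its
  -- sign nor a zero denominator (for instance `a q = p`, possible when `x + r < 1`) matters.
  have split (v : ℝ) :
      (modifiedTheta v p * modifiedTheta (a * v) p *
          modifiedTheta (b * q) p * modifiedTheta (a * q / b) p) /
        (modifiedTheta q p * modifiedTheta (a * q) p *
          modifiedTheta (b * v) p * modifiedTheta (a * v / b) p) =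
      (modifiedTheta (b * q) p * modifiedTheta (a * q / b) p /
        (modifiedTheta q p * modifiedTheta (a * q) p)) *
      (modifiedTheta v p * modifiedTheta (a * v) p /
        (modifiedTheta (b * v) p * modifiedTheta (a / b * v) p)) := by
    rw [div_mul_div_comm, ← div_mul_eq_mul_div a b v]
    congr 1 <;> ring
  have sq_factor (k u v : ℝ) : k * u * (k * v) = k ^ 2 * (u * v) := by ring
  simp only [split]
  rw [ge_iff_le, sq_factor, sq_factor]
  refine mul_le_mul_of_nonneg_left ?_ (sq_nonneg _)
  rw [div_mul_div_comm (modifiedTheta (X * R) p * _), div_mul_div_comm (modifiedTheta X p * _),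
    div_le_div_iff₀ (mul_pos p₁ p₄) (mul_pos p₂ p₃)]
  linear_combination main
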